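/- All matroids have finite ground sets. A matroid $M$ is a *gammoid* if there are a finite directed graph $D$, a set $B$ of vertices of $D$, and an injection $\varphi$ from $E(M)$ to the vertex set of $D$ such that a set $I\subseteq E(M)$ is independent in $M$ if and only if $\varphi(I)$ is linked into $B$, that is, there are pairwise vertex-disjoint directed paths in $D$ (single vertices being allowed as paths), one starting at each vertex of $\varphi(I)$, all ending in $B$. If $F$ is a flat of a matroid $M$ and $e\notin E(M)$, the *principal extension* of $M$ into $F$ by $e$ is the matroid $M'$ on $E(M)\cup\{e\}$ such that $M'\setminus e=M$ and a subset of $E(M)$ spans $e$ if and only if it spans $F$. A matroid is *$U_{0,0}$-constructed* if it can be obtained from the matroid $U_{0,0}$ with empty ground set by a finite (possibly empty) sequence of the following operations: relabelling elements, deletion, contraction, adding a coloop, and principal extension. **Theorem.** A matroid is a gammoid if and only if it is $U_{0,0}$-constructed. Equivalently, the class of gammoids is the smallest nonempty class of matroids that is closed under isomorphism, minors, adding coloops and principal extensions: it is such a class, and it is contained in every such class. -/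

import Mathlib

universe u

open Set
open scoped Matroid

namespace Digraph

/-- A directed path in `D`: a nonempty sequence of distinct vertices, each of which is joined to the
next one by an arc. A single vertex is a path. -/
structure IsDirectedPath {V : Type u} (D : Digraph V) (p : List V) : Prop where
  ne_nil : p ≠ []
  nodup : p.Nodup
  chain : p.IsChain D.Adj

/-- `X` is linked into `B` in `D`: there are pairwise vertex-disjoint directed paths, one starting at
each vertex of `X`, all of which end in `B`. -/
def LinkedInto {V : Type u} (D : Digraph V) (X B : Set V) : Prop :=
  ∃ P : V → List V,
    (∀ x ∈ X, D.IsDirectedPath (P x) ∧ (P x).head? = some x ∧ ∃ b ∈ B, (P x).getLast? = some b) ∧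
    ∀ x ∈ X, ∀ y ∈ X, x ≠ y → (P x).Disjoint (P y)

end Digraph

namespace Matroid

/-- `M` is a gammoid: for some finite digraph `D` and some set `B` of vertices of `D`, the elements
of `M` can be identified (by the injection `φ`) with vertices of `D` in such a way that a set of
elements of `M` is independent if and only if it is linked into `B`. -/
def IsGammoid {α : Type u} (M : Matroid α) : Prop :=
  ∃ (V : Type u) (_ : Finite V) (D : Digraph V) (B : Set V) (φ : M.E ↪ V),
    ∀ I : Set M.E, M.Indep ((↑) '' I) ↔ D.LinkedInto (φ '' I) B

/-- `M'` is obtained from `M` by adding the new element `e` as a coloop. -/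
structure IsColoopExtension {α : Type u} (M : Matroid α) (e : α) (M' : Matroid α) : Prop where
  notMem : e ∉ M.E
  ground : M'.E = insert e M.E
  delete_eq : M' ＼ {e} = M
  coloop : M'.IsColoop e

/-- `M'` is the principal extension of `M` into the flat `F` by the new element `e`. -/
structure IsPrincipalExtension {α : Type u} (M : Matroid α) (F : Set α) (e : α) (M' : Matroid α) :
    Prop where
  flat : M.IsFlat F
  notMem : e ∉ M.E
  ground : M'.E = insert e M.E
  delete_eq : M' ＼ {e} = M
  spans_iff : ∀ X ⊆ M.E, e ∈ M'.closure X ↔ F ⊆ M'.closure X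

/-- `Constructed N M`: the matroid `M` is `N`-constructed, that is, obtained from `N` by a finite
sequence of relabellings, deletions, contractions, additions of coloops and principal extensions.
A relabelling replaces the ground set by any set in bijection with it, possibly in another type. -/
inductive Constructed {γ : Type u} (N : Matroid γ) : {α : Type u} → Matroid α → Prop
  | base : Constructed N N
  | relabel {α β : Type u} {M : Matroid α} {E : Set β} (e : M.E ≃ E) :
      Constructed N M → Constructed N (M.mapSetEquiv e)
  | delete {α : Type u} {M : Matroid α} (D : Set α) : Constructed N M → Constructed N (M ＼ D)
  | contract {α : Type u} {M : Matroid α} (C : Set α) : Constructed N M → Constructed N (M ／ C)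
  | addColoop {α : Type u} {M M' : Matroid α} {e : α} :
      M.IsColoopExtension e M' → Constructed N M → Constructed N M'
  | principal {α : Type u} {M M' : Matroid α} {F : Set α} {e : α} :
      M.IsPrincipalExtension F e M' → Constructed N M → Constructed N M'

/-- The matroid `U_{0,0}` with empty ground set. -/
def U00 : Matroid PEmpty.{u + 1} := emptyOn PEmpty

/-- A class of matroids, given by its membership predicate. Classes are ordered by inclusion. -/
abbrev MatroidClass : Type (u + 1) := ∀ α : Type u, Matroid α → Prop

/-- `𝓒` is a nonempty class of finite matroids that is closed under isomorphism, minors, adding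
coloops and principal extensions. -/
structure IsClosedClass (𝓒 : MatroidClass.{u}) : Prop where
  finite : ∀ {α : Type u} {M : Matroid α}, 𝓒 α M → M.Finite
  nonempty : ∃ (α : Type u) (M : Matroid α), 𝓒 α M
  iso : ∀ {α β : Type u} {M : Matroid α} {E : Set β} (e : M.E ≃ E), 𝓒 α M → 𝓒 β (M.mapSetEquiv e)
  minor : ∀ {α : Type u} {M N : Matroid α}, N ≤m M → 𝓒 α M → 𝓒 α N
  addColoop : ∀ {α : Type u} {M M' : Matroid α} {e : α},
    M.IsColoopExtension e M' → 𝓒 α M → 𝓒 α M'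
  principal : ∀ {α : Type u} {M M' : Matroid α} {F : Set α} {e : α},
    M.IsPrincipalExtension F e M' → 𝓒 α M → 𝓒 α M'

end Matroid

/-!
By the linkage lemma, `X` is linked into `B` in a digraph if and only if the closed
out-neighbourhoods of the vertices outside `B` have a system of distinct representatives that avoids
`X`: a linkage moves every vertex outside `B` to its successor on its path, if there is one, and
iterating an injective choice of representatives from the vertices of `X` traces out the paths. So
the gammoids are the matroids whose independent sets are those avoided by some system of distinct
representatives of a finite family of sets, a form that survives contraction (remove a basis of the
contracted set from every set of the family) and principal extension into a flat `F` (adjoin the set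
`F ∪ {e}` to the family).

Conversely, start from the free matroid on the points and, for each set of the family, extend it
principally into the closure of that set. In the result, `X ∪ T` is independent, for `X` a set of
points and `T` a set of new elements, if and only if the sets of the family that belong to `T` have
a system of distinct representatives avoiding `X`, so contracting all new elements leaves the
presented gammoid.
-/

namespace Gammoid

section SDR

variable {W W' R R' : Type*} {A A' : W → Set R} {T : Set W} {X Y : Set R}

/-- The family of sets `A w`, indexed by `w ∈ T`, has a system of distinct representatives that
avoids `X`. -/
def HasSDRAvoiding (A : W → Set R) (T : Set W) (X : Set R) : Prop :=
  ∃ g : T → R, g.Injective ∧ ∀ w : T, g w ∈ A w \ X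

lemma HasSDRAvoiding.anti (hXY : X ⊆ Y) : HasSDRAvoiding A T Y → HasSDRAvoiding A T X :=
  fun ⟨g, hg, hgA⟩ ↦ ⟨g, hg, fun w ↦ sdiff_subset_sdiff_right hXY (hgA w)⟩

lemma hasSDRAvoiding_congr (h : ∀ w ∈ T, A w = A' w) :
    HasSDRAvoiding A T X ↔ HasSDRAvoiding A' T X := by
  simp only [HasSDRAvoiding, fun w : T ↦ h w w.2]

lemma hasSDRAvoiding_sdiff_iff :
    HasSDRAvoiding (fun w ↦ A w \ Y) T X ↔ HasSDRAvoiding A T (Y ∪ X) := by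
  simp only [HasSDRAvoiding, sdiff_sdiff]

lemma hasSDRAvoiding_index_image_iff {f : W → W'} {A : W' → Set R} (hf : InjOn f T) :
    HasSDRAvoiding A (f '' T) X ↔ HasSDRAvoiding (A ∘ f) T X := by
  let e : T ≃ f '' T := Equiv.Set.imageOfInjOn f T hf
  constructor
  · rintro ⟨g, hg, hgA⟩
    exact ⟨g ∘ e, hg.comp e.injective, fun w ↦ hgA (e w)⟩
  · rintro ⟨g, hg, hgA⟩
    refine ⟨g ∘ e.symm, hg.comp e.symm.injective, e.surjective.forall.2 fun w ↦ ?_⟩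
    rw [Function.comp_apply, e.symm_apply_apply]
    exact hgA w

lemma hasSDRAvoiding_comp_val_iff :
    HasSDRAvoiding (A ∘ ((↑) : T → W)) univ X ↔ HasSDRAvoiding A T X := by
  rw [← hasSDRAvoiding_index_image_iff Subtype.val_injective.injOn, Subtype.coe_image_univ]

lemma hasSDRAvoiding_point_image_iff {f : R → R'} (hf : f.Injective) {X : Set R'} :
    HasSDRAvoiding (fun w ↦ f '' A w) T X ↔ HasSDRAvoiding A T (f ⁻¹' X) := by
  constructor
  · rintro ⟨g, hg, hgA⟩
    choose g' hg'A hg' using fun w ↦ (hgA w).1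
    obtain rfl : f ∘ g' = g := funext hg'
    exact ⟨g', hg.of_comp, fun w ↦ ⟨hg'A w, (hgA w).2⟩⟩
  · rintro ⟨g, hg, hgA⟩
    exact ⟨f ∘ g, hf.comp hg, fun w ↦ ⟨mem_image_of_mem f (hgA w).1, (hgA w).2⟩⟩

lemma HasSDRAvoiding.exists_injOn (h : HasSDRAvoiding A T X) (g₀ : W → R) :
    ∃ g : W → R, InjOn g T ∧ (∀ w ∈ T, g w ∈ A w \ X) ∧ ∀ w ∉ T, g w = g₀ w := by
  obtain ⟨g, hg, hgA⟩ := h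
  have hext (w : T) : Function.extend Subtype.val g g₀ w = g w :=
    Subtype.val_injective.extend_apply ..
  refine ⟨Function.extend Subtype.val g g₀, fun v hv w hw h ↦ ?_, fun w hw ↦ ?_, fun w hw ↦
    Function.extend_apply' _ _ _ fun ⟨v, hv⟩ ↦ hw (hv ▸ v.2)⟩
  · exact congrArg Subtype.val (hg ((hext ⟨v, hv⟩).symm.trans (h.trans (hext ⟨w, hw⟩))))
  · exact hext ⟨w, hw⟩ ▸ hgA ⟨w, hw⟩

lemma hasSDRAvoiding_of_injOn {g : W → R} (hg : InjOn g T) (hgA : ∀ w ∈ T, g w ∈ A w \ X) :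
    HasSDRAvoiding A T X :=
  ⟨fun w ↦ g w, hg.injective, fun w ↦ hgA w w.2⟩

lemma hasSDRAvoiding_insert_iff {w : W} (hw : w ∉ T) :
    HasSDRAvoiding A (insert w T) X ↔ ∃ u ∈ A w \ X, HasSDRAvoiding A T (insert u X) := by
  constructor
  · rintro ⟨g, hg, hgA⟩
    let i := inclusion (subset_insert w T)
    refine ⟨g ⟨w, mem_insert w T⟩, hgA ⟨w, mem_insert w T⟩, g ∘ i,
      hg.comp (inclusion_injective _), fun v ↦ ⟨(hgA (i v)).1, ?_⟩⟩
    rintro (h | h)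
    · obtain rfl : (v : W) = w := congrArg Subtype.val (hg h)
      exact hw v.2
    · exact (hgA (i v)).2 h
  · rintro ⟨u, hu, h⟩
    obtain ⟨g, hg, hgA, hgw⟩ := h.exists_injOn fun _ ↦ u
    replace hgw : g w = u := hgw w hw
    refine hasSDRAvoiding_of_injOn (g := g) ((injOn_insert hw).2 ⟨hg, ?_⟩)
      (forall_mem_insert.2 ⟨hgw ▸ hu, fun v hv ↦ ⟨(hgA v hv).1, fun h ↦ (hgA v hv).2 (.inr h)⟩⟩)
    rintro ⟨v, hv, hvw⟩
    exact (hgA v hv).2 (.inl (hvw.trans hgw))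

lemma hasSDRAvoiding_elim_iff {A₀ : Set R} :
    HasSDRAvoiding (fun w : Option W ↦ w.elim A₀ A) (insert none (some '' T)) X ↔
      ∃ u ∈ A₀ \ X, HasSDRAvoiding A T (insert u X) := by
  rw [hasSDRAvoiding_insert_iff (by simp)]
  refine exists_congr fun u ↦ and_congr_right fun _ ↦ ?_
  exact hasSDRAvoiding_index_image_iff (Option.some_injective W).injOn

end SDR

section Paths

variable {V : Type*}

lemma rel_formPerm_of_isChain [DecidableEq V] {r : V → V → Prop} {p : List V} (hp : p.Nodup)
    (hr : p.IsChain r) {v : V} (hv : v ∈ p) (hlast : v ∉ p.getLast?) : r v (p.formPerm v) := by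
  obtain ⟨i, hi, rfl⟩ := List.getElem_of_mem hv
  have hi' : i + 1 < p.length := by
    contrapose! hlast
    obtain rfl : i = p.length - 1 := by lia
    rw [Option.mem_def, List.getLast?_eq_getElem?, List.getElem?_eq_getElem]
  rw [p.formPerm_apply_lt_getElem hp i hi']
  exact List.isChain_iff_getElem.1 hr i hi'

lemma formPerm_apply_eq_head_iff [DecidableEq V] {p : List V} {x v : V} (hx : x ∈ p.head?) :
    p.formPerm v = x ↔ v ∈ p.getLast? := by
  obtain ⟨l, rfl⟩ := List.head?_eq_some_iff.1 hx
  rw [List.formPerm_eq_head_iff_eq_getLast, eq_comm,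
    List.getLast?_eq_getLast_of_ne_nil (List.cons_ne_nil x l), Option.mem_some]

lemma exists_injective_eq_formPerm [DecidableEq V] {L : Set (List V)}
    (hL : L.Pairwise List.Disjoint) :
    ∃ g : V → V, g.Injective ∧ (∀ p ∈ L, ∀ v ∈ p, g v = p.formPerm v) ∧
      ∀ v, (∀ p ∈ L, v ∉ p) → g v = v := by
  have heq {p q v} (hp : p ∈ L) (hq : q ∈ L) (hvp : v ∈ p) (hvq : v ∈ q) : p = q :=
    hL.eq hp hq fun h ↦ h hvp hvq
  have hex (v : V) : ∃ u, (∀ p ∈ L, v ∈ p → u = p.formPerm v) ∧ ((∀ p ∈ L, v ∉ p) → u = v) := by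
    by_cases! hv : ∃ p ∈ L, v ∈ p
    · obtain ⟨p, hp, hvp⟩ := hv
      exact ⟨p.formPerm v, fun q hq hvq ↦ by rw [heq hp hq hvp hvq], fun h ↦ absurd hvp (h p hp)⟩
    · exact ⟨v, fun p hp hvp ↦ absurd hvp (hv p hp), fun _ ↦ rfl⟩
  choose g hgL hg using hex
  have hmem {p v} (hp : p ∈ L) : g v ∈ p ↔ v ∈ p := by
    refine ⟨fun h ↦ ?_, fun h ↦ hgL v p hp h ▸ p.formPerm_apply_mem_of_mem h⟩
    by_cases! hv : ∃ q ∈ L, v ∈ q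
    · obtain ⟨q, hq, hvq⟩ := hv
      rw [hgL v q hq hvq] at h
      rwa [heq hp hq h (q.formPerm_apply_mem_of_mem hvq)]
    · rwa [hg v hv] at h
  refine ⟨g, fun v v' h ↦ ?_, fun p hp v ↦ hgL v p hp, hg⟩
  by_cases! hv : ∃ p ∈ L, v ∈ p
  · obtain ⟨p, hp, hvp⟩ := hv
    have hvp' : v' ∈ p := by rwa [← hmem hp, ← h, hmem hp]
    rw [hgL v p hp hvp, hgL v' p hp hvp'] at h
    exact p.formPerm.injective h
  · have hv' : ∀ p ∈ L, v' ∉ p := fun p hp ↦ by rw [← hmem hp, ← h, hmem hp]; exact hv p hp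
    rwa [hg v hv, hg v' hv'] at h

section Iterate

variable {G : V → V} {T X : Set V} {x y : V}

lemma eq_of_iterate_eq (hG : InjOn G T) (hGX : ∀ v ∈ T, G v ∉ X) (hx : x ∈ X) (hy : y ∈ X) :
    ∀ {i j : ℕ}, (∀ k < i, G^[k] x ∈ T) → (∀ k < j, G^[k] y ∈ T) → G^[i] x = G^[j] y →
      x = y ∧ i = j
  | 0, 0, _, _, h => ⟨h, rfl⟩
  | 0, j + 1, _, hj, h => by
    rw [Function.iterate_succ_apply'] at h
    exact absurd (h ▸ hx) (hGX _ (hj j j.lt_add_one))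
  | i + 1, 0, hi, _, h => by
    rw [Function.iterate_succ_apply'] at h
    exact absurd (h ▸ hy) (hGX _ (hi i i.lt_add_one))
  | i + 1, j + 1, hi, hj, h => by
    rw [Function.iterate_succ_apply', Function.iterate_succ_apply'] at h
    obtain ⟨rfl, rfl⟩ := eq_of_iterate_eq hG hGX hx hy (fun k hk ↦ hi k (by lia))
      (fun k hk ↦ hj k (by lia)) (hG (hi i i.lt_add_one) (hj j j.lt_add_one) h)
    exact ⟨rfl, rfl⟩

lemma exists_iterate_notMem [Finite V] (hG : InjOn G T) (hGX : ∀ v ∈ T, G v ∉ X) (hx : x ∈ X) :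
    ∃ n, G^[n] x ∉ T ∧ ∀ k < n, G^[k] x ∈ T := by
  classical
  have hex : ∃ n, G^[n] x ∉ T := by
    by_contra! h
    exact not_injective_infinite_finite (fun n ↦ G^[n] x) fun i j hij ↦
      (eq_of_iterate_eq hG hGX hx hx (fun k _ ↦ h k) (fun k _ ↦ h k) hij).2
  exact ⟨Nat.find hex, Nat.find_spec hex, fun k hk ↦ not_not.1 (Nat.find_min hex hk)⟩

end Iterate

end Paths

section Linkage

variable {V : Type u} {D : Digraph V} {X B : Set V}

lemma hasSDRAvoiding_of_linkedInto (h : D.LinkedInto X B) :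
    HasSDRAvoiding (fun w ↦ insert w {u | D.Adj w u}) Bᶜ X := by
  classical
  obtain ⟨P, hP, hdisj⟩ := h
  have hL : (P '' X).Pairwise List.Disjoint := by
    rintro _ ⟨x, hx, rfl⟩ _ ⟨y, hy, rfl⟩ hxy
    exact hdisj x hx y hy (ne_of_apply_ne P hxy)
  obtain ⟨g, hg, hgP, hgid⟩ := exists_injective_eq_formPerm hL
  have hlast {x w} (hx : x ∈ X) (hw : w ∈ (P x).getLast?) : w ∈ B := by
    obtain ⟨-, -, b, hb, hb'⟩ := hP x hx
    exact Option.mem_unique hw hb' ▸ hb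
  refine ⟨fun w ↦ g w, hg.comp Subtype.val_injective, fun ⟨w, hw⟩ ↦
    ⟨show g w ∈ insert w {u | D.Adj w u} from ?_, fun hwX ↦ ?_⟩⟩
  · by_cases! hwP : ∃ x ∈ X, w ∈ P x
    · obtain ⟨x, hx, hwx⟩ := hwP
      rw [hgP _ (mem_image_of_mem P hx) w hwx]
      exact .inr (rel_formPerm_of_isChain (hP x hx).1.nodup (hP x hx).1.chain hwx
        fun h ↦ hw (hlast hx h))
    · exact .inl (hgid w (forall_mem_image.2 hwP))
  · -- `g` maps the last vertex of the path `P (g w)` back to its first vertex `g w`.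
    obtain ⟨-, hhead, b, hb, hb'⟩ := hP _ hwX
    have hgb : g b = g w := by
      rw [hgP _ (mem_image_of_mem P hwX) b (List.mem_of_mem_getLast? hb')]
      exact (formPerm_apply_eq_head_iff hhead).2 hb'
    exact hw (hg hgb ▸ hb)

lemma linkedInto_of_hasSDRAvoiding [Finite V]
    (h : HasSDRAvoiding (fun w ↦ insert w {u | D.Adj w u}) Bᶜ X) : D.LinkedInto X B := by
  obtain ⟨G, hG, hGmem, -⟩ := h.exists_injOn id
  have hGX (v) (hv : v ∈ Bᶜ) : G v ∉ X := (hGmem v hv).2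
  choose! n hn hlt using fun x (hx : x ∈ X) ↦ exists_iterate_notMem hG hGX hx
  have hpath {x y i j} (hx : x ∈ X) (hy : y ∈ X) (hi : i ≤ n x) (hj : j ≤ n y) :
      G^[i] x = G^[j] y → x = y ∧ i = j :=
    eq_of_iterate_eq hG hGX hx hy (fun k hk ↦ hlt x hx k (by lia)) fun k hk ↦ hlt y hy k (by lia)
  have hle {i n : ℕ} (hi : i ∈ List.range (n + 1)) : i ≤ n :=
    Nat.le_of_lt_succ (List.mem_range.1 hi)
  refine ⟨fun x ↦ (List.range (n x + 1)).map (G^[·] x), fun x hx ↦ ⟨⟨by simp, ?_, ?_⟩, by simp,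
    G^[n x] x, not_not.1 (hn x hx), by simp [List.range_succ]⟩, fun x hx y hy hxy ↦ ?_⟩
  · refine List.nodup_range.map_on fun i hi j hj h ↦ ?_
    exact (hpath hx hx (hle hi) (hle hj) h).2
  · refine List.isChain_iff_getElem.2 fun i hi ↦ ?_
    replace hi : i < n x := by simpa using hi
    simp only [List.getElem_map, List.getElem_range]
    rw [Function.iterate_succ_apply']
    refine (hGmem _ (hlt x hx i hi)).1.resolve_left fun h ↦ ?_
    rw [← Function.iterate_succ_apply' G] at h
    exact absurd (hpath hx hx hi hi.le h).2 i.succ_ne_self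
  · intro v hvx hvy
    obtain ⟨i, hi, rfl⟩ := List.mem_map.1 hvx
    obtain ⟨j, hj, h⟩ := List.mem_map.1 hvy
    exact hxy (hpath hx hy (hle hi) (hle hj) h.symm).1

lemma linkedInto_iff_hasSDRAvoiding [Finite V] :
    D.LinkedInto X B ↔ HasSDRAvoiding (fun w ↦ insert w {u | D.Adj w u}) Bᶜ X :=
  ⟨hasSDRAvoiding_of_linkedInto, linkedInto_of_hasSDRAvoiding⟩

end Linkage

open Matroid

section PrincipalExtension

variable {α : Type u} {M M' : Matroid α} {e : α} {F I J X : Set α}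

lemma indep_iff_of_deleteElem_eq (h : M' ＼ {e} = M) (he : e ∉ I) : M'.Indep I ↔ M.Indep I := by
  rw [← h, deleteElem_indep_iff, and_iff_left he]

lemma indep_iff_of_isColoopExtension (h : M.IsColoopExtension e M') :
    M'.Indep I ↔ M.Indep (I \ {e}) := by
  rw [← indep_iff_of_deleteElem_eq h.delete_eq (notMem_sdiff_of_mem (mem_singleton e))]
  refine ⟨fun hI ↦ hI.subset sdiff_subset, fun hI ↦ ?_⟩
  exact (h.coloop.insert_indep_of_indep hI).subset (subset_insert_sdiff_singleton e I)

lemma not_subset_closure_iff (hI : M.Indep I) (hF : F ⊆ M.E) :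
    ¬ F ⊆ M.closure I ↔ ∃ f ∈ F \ I, M.Indep (insert f I) := by
  simp only [not_subset, mem_sdiff, and_assoc]
  refine exists_congr fun f ↦ and_congr_right fun hf ↦ ?_
  rw [hI.notMem_closure_iff (hF hf), and_comm]

lemma exists_insert_indep_closure_iff (hX : X ⊆ M.E) :
    (∃ f ∈ M.closure X \ I, M.Indep (insert f I)) ↔ ∃ f ∈ X \ I, M.Indep (insert f I) := by
  by_cases hI : M.Indep I
  · rw [← not_subset_closure_iff hI (M.closure_subset_ground X), ← not_subset_closure_iff hI hX,
      closure_subset_closure_iff_subset_closure hX]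
  · refine iff_of_false ?_ ?_ <;> rintro ⟨f, -, hf⟩ <;> exact hI (hf.subset (subset_insert f I))

lemma forall_spans_iff_iff (he : e ∉ M.E) (hE : M'.E = insert e M.E) (hM : M' ＼ {e} = M)
    (hF : F ⊆ M.E) :
    (∀ X ⊆ M.E, e ∈ M'.closure X ↔ F ⊆ M'.closure X) ↔
      ∀ I ⊆ M.E, (M'.Indep (insert e I) ↔ ∃ f ∈ F \ I, M.Indep (insert f I)) := by
  have hindep {I : Set α} (hI : I ⊆ M.E) : M'.Indep I ↔ M.Indep I :=
    indep_iff_of_deleteElem_eq hM fun h ↦ he (hI h)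
  have hspans {I : Set α} (hI : M.Indep I) : (e ∈ M'.closure I ↔ F ⊆ M'.closure I) ↔
      (M'.Indep (insert e I) ↔ ∃ f ∈ F \ I, M.Indep (insert f I)) := by
    have hI' : M'.Indep I := (hindep hI.subset_ground).2 hI
    have heI : e ∉ I := fun h ↦ he (hI.subset_ground h)
    rw [← not_iff_not (a := e ∈ _), hI'.notMem_closure_iff_of_notMem heI (hE ▸ mem_insert e M.E),
      not_subset_closure_iff hI' (hE ▸ hF.trans (subset_insert e M.E))]
    refine iff_congr .rfl (exists_congr fun f ↦ and_congr_right fun hf ↦ ?_)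
    exact hindep (insert_subset (hF hf.1) hI.subset_ground)
  constructor
  · intro h I hI
    by_cases hI' : M.Indep I
    · exact (hspans hI').1 (h I hI)
    · refine iff_of_false (fun h ↦ hI' ?_) fun ⟨f, _, h⟩ ↦ hI' (h.subset (subset_insert f I))
      exact (hindep hI).1 (h.subset (subset_insert e I))
  · intro h X hX
    obtain ⟨I, hI⟩ := M'.exists_isBasis X (hE ▸ hX.trans (subset_insert e M.E))
    have hIX : I ⊆ M.E := hI.subset.trans hX
    rw [← hI.closure_eq_closure]
    exact (hspans ((hindep hIX).1 hI.indep)).2 (h I hIX)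

lemma indep_insert_iff_of_isPrincipalExtension (h : M.IsPrincipalExtension (M.closure F) e M')
    (hF : F ⊆ M.E) (hI : I ⊆ M.E) :
    M'.Indep (insert e I) ↔ ∃ f ∈ F \ I, M.Indep (insert f I) := by
  rw [← exists_insert_indep_closure_iff hF]
  exact (forall_spans_iff_iff h.notMem h.ground h.delete_eq
    (M.closure_subset_ground F)).1 h.spans_iff I hI

lemma encard_le_encard_insert_sdiff_singleton {f : α} (hf : f ∉ I) :
    I.encard ≤ (insert f (I \ {e})).encard := by
  rw [encard_insert_of_notMem fun h ↦ hf h.1, ← encard_insert_of_notMem (a := e) (by simp)]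
  exact encard_le_encard (subset_insert_sdiff_singleton e I)

/-- The independent sets of the principal extension of `M` into `F` by `e`: if `I` contains the new
element `e`, then some element of `F` can take its place. For `e ∉ I` the second alternative implies
the first one. -/
def PrincipalIndep (M : Matroid α) (F : Set α) (e : α) (I : Set α) : Prop :=
  M.Indep I ∨ ∃ f ∈ F \ I, M.Indep (insert f (I \ {e}))

lemma principalIndep_iff_of_notMem (heI : e ∉ I) : PrincipalIndep M F e I ↔ M.Indep I := by
  refine or_iff_left_of_imp fun ⟨f, _, hf⟩ ↦ hf.subset ?_
  rw [sdiff_singleton_eq_self heI]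
  exact subset_insert f I

lemma principalIndep_insert_iff (he : e ∉ M.E) (heI : e ∉ I) :
    PrincipalIndep M F e (insert e I) ↔ ∃ f ∈ F \ I, M.Indep (insert f I) := by
  rw [PrincipalIndep, or_iff_right fun h ↦ he (h.subset_ground (mem_insert e I)),
    insert_sdiff_self_of_notMem heI]
  refine exists_congr fun f ↦ and_congr_left fun hf ↦ ?_
  have hfe : f ≠ e := ne_of_mem_of_not_mem (hf.subset_ground (mem_insert f I)) he
  rw [mem_sdiff, mem_sdiff, mem_insert_iff, or_iff_right hfe]

lemma PrincipalIndep.subset (hJ : PrincipalIndep M F e J) (hIJ : I ⊆ J) :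
    PrincipalIndep M F e I :=
  hJ.imp (·.subset hIJ) fun ⟨f, hf, h⟩ ↦ ⟨f, sdiff_subset_sdiff_right hIJ hf,
    h.subset (insert_subset_insert (sdiff_subset_sdiff_left hIJ))⟩

lemma PrincipalIndep.encard_le_eRank (hI : PrincipalIndep M F e I) : I.encard ≤ M.eRank := by
  obtain h | ⟨f, hf, h⟩ := hI
  · exact h.encard_le_eRank
  · exact (encard_le_encard_insert_sdiff_singleton hf.2).trans h.encard_le_eRank

lemma PrincipalIndep.exists_indep (he : e ∉ M.E) (hJ : PrincipalIndep M F e J) :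
    ∃ K, M.Indep K ∧ J.encard ≤ K.encard ∧ ∀ x ∈ K, x ∈ J ∨ x ∈ F \ J ∧ e ∈ J := by
  by_cases heJ : e ∈ J
  · obtain hJ | ⟨g, hg, hgJ⟩ := hJ
    · exact absurd (hJ.subset_ground heJ) he
    · exact ⟨_, hgJ, encard_le_encard_insert_sdiff_singleton hg.2,
        forall_mem_insert.2 ⟨.inr ⟨hg, heJ⟩, fun x hx ↦ .inl hx.1⟩⟩
  · exact ⟨J, (principalIndep_iff_of_notMem heJ).1 hJ, le_rfl, fun x hx ↦ .inl hx⟩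

lemma exists_principalIndep_insert_of_indep (he : e ∉ M.E) (hI : M.Indep I)
    (hJ : PrincipalIndep M F e J) (hIJ : I.encard < J.encard) :
    ∃ x ∈ J \ I, PrincipalIndep M F e (insert x I) := by
  obtain ⟨K, hK, hJK, hKJ⟩ := hJ.exists_indep he
  obtain ⟨x, ⟨hxK, hxI⟩, hx⟩ := hI.augment hK (hIJ.trans_le hJK)
  obtain hxJ | ⟨hxF, heJ⟩ := hKJ x hxK
  · exact ⟨x, ⟨hxJ, hxI⟩, .inl hx⟩
  · have heI : e ∉ I := fun h ↦ he (hI.subset_ground h)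
    exact ⟨e, ⟨heJ, heI⟩, (principalIndep_insert_iff he heI).2 ⟨x, ⟨hxF.1, hxI⟩, hx⟩⟩

lemma exists_insert_insert_indep {f g : α} (hf : f ∉ I) (hg : g ∉ insert f I)
    (hI : M.Indep (insert g (insert f I))) (hJ : M.Indep J) (hIJ : I.encard < J.encard) :
    ∃ y ∈ J \ I, ∃ z ∈ {f, g} \ insert y I, M.Indep (insert z (insert y I)) := by
  obtain ⟨y, hy, hyI⟩ := (hI.subset ((subset_insert f I).trans (subset_insert g _))).augment hJ hIJ
  have hcard : (insert y I).encard < (insert g (insert f I)).encard := by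
    rw [encard_insert_of_notMem hy.2, encard_insert_of_notMem hg, encard_insert_of_notMem hf]
    exact (ENat.lt_add_one_iff (by simpa using hIJ.ne_top)).2 le_rfl
  obtain ⟨z, ⟨hzI, hzy⟩, hz⟩ := hyI.augment hI hcard
  refine ⟨y, hy, z, ⟨?_, hzy⟩, hz⟩
  obtain rfl | rfl | hzI := hzI
  exacts [.inr rfl, .inl rfl, absurd (.inr hzI) hzy]

lemma exists_principalIndep_insert_of_indep_insert {f : α} (he : e ∉ M.E) (heI : e ∉ I)
    (hf : f ∈ F \ I) (hI : M.Indep (insert f I)) (hJ : PrincipalIndep M F e J)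
    (hIJ : (insert e I).encard < J.encard) :
    ∃ x ∈ J \ insert e I, PrincipalIndep M F e (insert x (insert e I)) := by
  have hne {x y : α} (hxy : M.Indep (insert x (insert y I))) : e ∉ insert y I :=
    fun h ↦ he (hxy.subset_ground (.inr h))
  suffices ∃ y ∈ J \ I, ∃ z ∈ F \ insert y I, M.Indep (insert z (insert y I)) by
    obtain ⟨y, hy, z, hz, hzy⟩ := this
    have hey := hne hzy
    refine ⟨y, ⟨hy.1, ?_⟩, ?_⟩
    · rintro (rfl | h)
      exacts [hey (mem_insert y I), hy.2 h]
    · rw [insert_comm, principalIndep_insert_iff he hey]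
      exact ⟨z, hz, hzy⟩
  rw [encard_insert_of_notMem heI, ← encard_insert_of_notMem hf.2] at hIJ
  obtain ⟨K, hK, hJK, hKJ⟩ := hJ.exists_indep he
  obtain ⟨x, ⟨hxK, hxI⟩, hx⟩ := hI.augment hK (hIJ.trans_le hJK)
  obtain hxJ | ⟨hxF, heJ⟩ := hKJ x hxK
  · refine ⟨x, ⟨hxJ, fun h ↦ hxI (.inr h)⟩, f, ⟨hf.1, ?_⟩, insert_comm x f I ▸ hx⟩
    rintro (rfl | h)
    exacts [hxI (mem_insert f I), hf.2 h]
  · have hJ' : M.Indep (J \ {e}) :=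
      (principalIndep_iff_of_notMem fun h ↦ h.2 rfl).1 (hJ.subset sdiff_subset)
    rw [encard_insert_of_notMem hf.2, ← encard_sdiff_singleton_add_one heJ] at hIJ
    obtain ⟨y, hy, z, ⟨hzfx, hzy⟩, hz⟩ :=
      exists_insert_insert_indep hf.2 hxI hx hJ' (lt_of_add_lt_add_right hIJ)
    refine ⟨y, ⟨hy.1.1, hy.2⟩, z, ⟨?_, hzy⟩, hz⟩
    obtain rfl | rfl := hzfx
    exacts [hf.1, hxF.1]

lemma exists_principalIndep_insert (he : e ∉ M.E) (hI : PrincipalIndep M F e I)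
    (hJ : PrincipalIndep M F e J) (hIJ : I.encard < J.encard) :
    ∃ x ∈ J \ I, PrincipalIndep M F e (insert x I) := by
  by_cases heI : e ∈ I
  · have heI' : e ∉ I \ {e} := fun h ↦ h.2 rfl
    rw [← insert_sdiff_self_of_mem heI] at hI hIJ ⊢
    obtain ⟨f, hf, hfI⟩ := (principalIndep_insert_iff he heI').1 hI
    exact exists_principalIndep_insert_of_indep_insert he heI' hf hfI hJ hIJ
  · exact exists_principalIndep_insert_of_indep he ((principalIndep_iff_of_notMem heI).1 hI) hJ hIJ

lemma exists_isPrincipalExtension [M.RankFinite] (hF : M.IsFlat F) (he : e ∉ M.E) :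
    ∃ M', M.IsPrincipalExtension F e M' := by
  let N : IndepMatroid α := .ofBddAugment (insert e M.E) (PrincipalIndep M F e)
    (indep_empty := .inl M.empty_indep)
    (indep_subset := fun _ _ hJ hIJ ↦ hJ.subset hIJ)
    (indep_aug := fun I J hI hJ hIJ ↦ by
      simpa only [mem_sdiff, and_assoc] using exists_principalIndep_insert he hI hJ hIJ)
    (indep_bdd := by
      obtain ⟨n, hn⟩ := ENat.ne_top_iff_exists.1 (M.eRank_ne_top_iff.2 ‹_›)
      exact ⟨n, fun I hI ↦ hn ▸ hI.encard_le_eRank⟩)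
    (subset_ground := by
      rintro I (hI | ⟨f, -, hf⟩)
      · exact hI.subset_ground.trans (subset_insert e M.E)
      · rw [← sdiff_singleton_subset_iff]
        exact (subset_insert f _).trans hf.subset_ground)
  have hdel : N.matroid ＼ {e} = M := by
    refine ext_indep (insert_sdiff_self_of_notMem he) fun I hI ↦ ?_
    have heI : e ∉ I := fun h ↦ (hI h).2 rfl
    rw [deleteElem_indep_iff, and_iff_left heI]
    exact principalIndep_iff_of_notMem heI
  refine ⟨N.matroid, hF, he, rfl, hdel,
    (forall_spans_iff_iff he rfl hdel hF.subset_ground).2 fun I hI ↦ ?_⟩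
  exact principalIndep_insert_iff he fun h ↦ he (hI h)

end PrincipalExtension

section Presentation

variable {α : Type u} {M M' : Matroid α} {e : α} {F : Set α}

/-- `M` is presented by a finite family of sets `A w`, indexed by `w ∈ T`: the elements of `M` are
identified with points in such a way that the independent sets are those that some system of
distinct representatives avoids. In other words, `M` is the dual of a transversal matroid, up to
deletions. -/
def IsPresented (M : Matroid α) : Prop :=
  ∃ (W R : Type u) (_ : Finite W) (_ : Finite R) (A : W → Set R) (T : Set W) (φ : α → R),
    InjOn φ M.E ∧ ∀ I ⊆ M.E, M.Indep I ↔ HasSDRAvoiding A T (φ '' I)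

lemma isPresented_of_isGammoid (h : M.IsGammoid) : IsPresented M := by
  obtain ⟨V, _, D, B, φ, h⟩ := h
  let φ' : α → Option V := Function.extend Subtype.val (some ∘ φ) fun _ ↦ none
  have hφ' (a : M.E) : φ' a = some (φ a) := Subtype.val_injective.extend_apply _ _ a
  refine ⟨V, Option V, inferInstance, inferInstance,
    fun w ↦ some '' insert w {u | D.Adj w u}, Bᶜ, φ', ?_, fun I hI ↦ ?_⟩
  · rw [injOn_iff_injective, show M.E.domRestrict φ' = some ∘ φ from funext hφ']
    exact (Option.some_injective V).comp φ.injective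
  · lift I to Set M.E using hI
    have hφI : φ' '' ((↑) '' I) = some '' (φ '' I) := by simp only [image_image, hφ']
    rw [h, linkedInto_iff_hasSDRAvoiding, hasSDRAvoiding_point_image_iff (Option.some_injective V),
      hφI, preimage_image_eq _ (Option.some_injective V)]

lemma isGammoid_of_isPresented (h : IsPresented M) : M.IsGammoid := by
  obtain ⟨W, R, _, _, A, T, φ, hφ, h⟩ := h
  obtain ⟨g₀, hg₀, hg₀A⟩ := (h ∅ (empty_subset _)).1 M.empty_indep
  refine ⟨R, inferInstance, ⟨fun v u ↦ ∃ w, g₀ w = v ∧ u ∈ A w⟩, (range g₀)ᶜ,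
    ⟨M.E.domRestrict φ, hφ.injective⟩, fun I ↦ ?_⟩
  rw [h _ (Subtype.coe_image_subset _ _), linkedInto_iff_hasSDRAvoiding, compl_compl,
    ← image_univ, hasSDRAvoiding_index_image_iff hg₀.injOn, ← hasSDRAvoiding_comp_val_iff,
    image_image]
  refine hasSDRAvoiding_congr fun w _ ↦ ?_
  have hout : {u | ∃ w', g₀ w' = g₀ w ∧ u ∈ A w'} = A w := by
    simp only [hg₀.eq_iff, exists_eq_left, ofPred_mem_eq]
  exact ((congrArg (insert (g₀ w)) hout).trans (insert_eq_self.2 (hg₀A w).1)).symm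

lemma isGammoid_iff_isPresented : M.IsGammoid ↔ IsPresented M :=
  ⟨isPresented_of_isGammoid, isGammoid_of_isPresented⟩

lemma IsPresented.delete (h : IsPresented M) (D : Set α) : IsPresented (M ＼ D) := by
  obtain ⟨W, R, hW, hR, A, T, φ, hφ, h⟩ := h
  refine ⟨W, R, hW, hR, A, T, φ, hφ.mono sdiff_subset, fun I hI ↦ ?_⟩
  rw [delete_ground, subset_sdiff] at hI
  rw [delete_indep_iff, and_iff_left hI.2, h I hI.1]

lemma IsPresented.contract (h : IsPresented M) (C : Set α) : IsPresented (M ／ C) := by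
  obtain ⟨W, R, hW, hR, A, T, φ, hφ, h⟩ := h
  obtain ⟨J, hJ⟩ := M.exists_isBasis' C
  refine ⟨W, R, hW, hR, fun w ↦ A w \ φ '' J, T, φ, hφ.mono sdiff_subset, fun I hI ↦ ?_⟩
  rw [contract_ground, subset_sdiff] at hI
  rw [hJ.contract_indep_iff, and_iff_left hI.2.symm,
    h _ (union_subset hI.1 hJ.indep.subset_ground), union_comm, image_union,
    hasSDRAvoiding_sdiff_iff]

lemma preimage_some_insert_none {R : Type*} (X : Set (Option R)) :
    some ⁻¹' insert none X = some ⁻¹' X := by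
  ext
  simp

lemma isPresented_of_extension {W R : Type u} [Finite W] [Finite R] {A : W → Set (Option R)}
    {T : Set W} {φ : α → R} (he : e ∉ M.E) (hE : M'.E = insert e M.E) (hφ : InjOn φ M.E)
    (h : ∀ I ⊆ M.E, M'.Indep I ↔ HasSDRAvoiding A T (some '' (φ '' I)))
    (h' : ∀ I ⊆ M.E, M'.Indep (insert e I) ↔ HasSDRAvoiding A T (insert none (some '' (φ '' I)))) :
    IsPresented M' := by
  classical
  let φ' : α → Option R := Function.update (some ∘ φ) e none
  have heq : EqOn φ' (some ∘ φ) M.E := fun a ha ↦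
    Function.update_of_ne (ne_of_mem_of_not_mem ha he) ..
  have hφ' {I : Set α} (hI : I ⊆ M.E) : φ' '' I = some '' (φ '' I) := by
    rw [← image_comp]
    exact (heq.mono hI).image_eq
  have hφ'e : φ' e = none := Function.update_self ..
  refine ⟨W, Option R, inferInstance, inferInstance, A, T, φ', ?_, fun I hI ↦ ?_⟩
  · rw [hE, injOn_insert he, hφ'e, hφ' subset_rfl]
    exact ⟨heq.injOn_iff.2 ((Option.some_injective R).comp_injOn hφ), by simp⟩
  · rw [hE] at hI
    by_cases heI : e ∈ I
    · have hI' := sdiff_singleton_subset_iff.2 hI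
      rw [← insert_sdiff_self_of_mem heI, h' _ hI', image_insert_eq, hφ'e, hφ' hI']
    · have hI' := (subset_insert_iff_of_notMem heI).1 hI
      rw [h I hI', hφ' hI']

lemma isPresented_of_isColoopExtension (h : IsPresented M) (h' : M.IsColoopExtension e M') :
    IsPresented M' := by
  obtain ⟨W, R, _, _, A, T, φ, hφ, h⟩ := h
  have hsome := Option.some_injective R
  refine isPresented_of_extension (A := fun w ↦ some '' A w) (T := T) h'.notMem h'.ground hφ
    (fun I hI ↦ ?_) fun I hI ↦ ?_ <;> have heI : e ∉ I := fun h ↦ h'.notMem (hI h)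
  · rw [indep_iff_of_deleteElem_eq h'.delete_eq heI, h I hI, hasSDRAvoiding_point_image_iff hsome,
      preimage_image_eq _ hsome]
  · rw [indep_iff_of_isColoopExtension h', insert_sdiff_self_of_notMem heI, h I hI,
      hasSDRAvoiding_point_image_iff hsome, preimage_some_insert_none, preimage_image_eq _ hsome]

lemma isPresented_of_isPrincipalExtension (h : IsPresented M)
    (h' : M.IsPrincipalExtension F e M') : IsPresented M' := by
  obtain ⟨W, R, _, _, A, T, φ, hφ, h⟩ := h
  have hsome := Option.some_injective R
  let A' : Option W → Set (Option R) := fun w ↦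
    w.elim (insert none (some '' (φ '' F))) fun w ↦ some '' A w
  have hA' (X : Set (Option R)) : HasSDRAvoiding A' (insert none (some '' T)) X ↔
      ∃ u ∈ insert none (some '' (φ '' F)) \ X, HasSDRAvoiding A T (some ⁻¹' insert u X) := by
    simp only [A', hasSDRAvoiding_elim_iff, hasSDRAvoiding_point_image_iff hsome]
  refine isPresented_of_extension (A := A') (T := insert none (some '' T)) h'.notMem h'.ground hφ
    (fun I hI ↦ ?_) fun I hI ↦ ?_ <;> have heI : e ∉ I := fun h ↦ h'.notMem (hI h)
  · rw [indep_iff_of_deleteElem_eq h'.delete_eq heI, h I hI, hA']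
    constructor
    · refine fun hI ↦ ⟨none, ⟨mem_insert none _, by simp⟩, ?_⟩
      rwa [preimage_some_insert_none, preimage_image_eq _ hsome]
    · rintro ⟨u, -, hu⟩
      exact hu.anti fun v hv ↦ .inr (mem_image_of_mem some hv)
  · have hF := h'.flat.subset_ground
    rw [← h'.flat.closure] at h'
    rw [indep_insert_iff_of_isPrincipalExtension h' hF hI, hA']
    have hmem {f} (hf : f ∈ F) : some (φ f) ∈ insert none (some '' (φ '' I)) ↔ f ∈ I := by
      rw [mem_insert_iff, or_iff_right (Option.some_ne_none _), hsome.mem_set_image,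
        hφ.mem_image_iff hI (hF hf)]
    have hins {f} (hf : f ∈ F) : M.Indep (insert f I) ↔
        HasSDRAvoiding A T (some ⁻¹' insert (some (φ f)) (insert none (some '' (φ '' I)))) := by
      rw [h _ (insert_subset (hF hf) hI), insert_comm, preimage_some_insert_none,
        ← image_insert_eq, preimage_image_eq _ hsome, image_insert_eq]
    constructor
    · rintro ⟨f, ⟨hf, hfI⟩, hind⟩
      have hfF : some (φ f) ∈ some '' (φ '' F) := mem_image_of_mem some (mem_image_of_mem φ hf)
      exact ⟨some (φ f), ⟨.inr hfF, (hmem hf).not.2 hfI⟩, (hins hf).1 hind⟩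
    · rintro ⟨_, ⟨rfl | ⟨_, ⟨f, hf, rfl⟩, rfl⟩, hu⟩, hsdr⟩
      · exact absurd (mem_insert none _) hu
      · exact ⟨f, ⟨hf, (hmem hf).not.1 hu⟩, (hins hf).2 hsdr⟩

end Presentation

section Constructed

variable {α β : Type u} {M : Matroid α}

lemma constructed_freeOn {S : Set α} (hS : S.Finite) : Constructed U00.{u} (freeOn S) := by
  induction S, hS using Set.Finite.induction_on with
  | empty =>
    have : IsEmpty U00.{u}.E := inferInstanceAs (IsEmpty (∅ : Set PEmpty))
    have h := Constructed.relabel (Equiv.equivOfIsEmpty U00.{u}.E (∅ : Set α)) .base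
    rwa [ground_eq_empty_iff.1 (mapSetEquiv.ground _ _), ← freeOn_empty] at h
  | @insert e S he _ ih =>
    refine .addColoop (e := e) ⟨he, rfl, ?_, by simp [isColoop_iff_forall_mem_isBase]⟩ ih
    refine ext_indep (insert_sdiff_self_of_notMem he) fun I hI ↦ ?_
    have heI : e ∉ I := fun h ↦ (hI h).2 rfl
    rw [deleteElem_indep_iff, and_iff_left heI, freeOn_indep_iff, freeOn_indep_iff,
      subset_insert_iff_of_notMem heI]

lemma mapSetEquiv_indep_image_val_iff {E : Set β} (e : M.E ≃ E) (I : Set E) :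
    (M.mapSetEquiv e).Indep ((↑) '' I) ↔ M.Indep ((↑) '' (e.symm '' I)) := by
  have hI : (↑) ⁻¹' ((↑) '' I : Set β) = I := preimage_image_eq I Subtype.val_injective
  refine (mapSetEquiv_indep_iff M e).trans <| (and_iff_left (Subtype.coe_image_subset E I)).trans ?_
  exact iff_of_eq (congrArg (fun J : Set E ↦ M.Indep ((↑) '' (e.symm '' J))) hI)

lemma constructed_of_image {γ : Type u} {N : Matroid γ} {L : Matroid β} {f : α → β}
    (hL : Constructed N L) (hf : InjOn f M.E) (hE : L.E = f '' M.E)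
    (h : ∀ I ⊆ M.E, M.Indep I ↔ L.Indep (f '' I)) : Constructed N M := by
  let e : L.E ≃ M.E := (Equiv.setCongr hE).trans (Equiv.Set.imageOfInjOn f M.E hf).symm
  suffices L.mapSetEquiv e = M from this ▸ hL.relabel e
  refine ext_indep rfl fun I hI ↦ ?_
  replace hI : I ⊆ M.E := hI
  lift I to Set M.E using hI
  rw [mapSetEquiv_indep_image_val_iff, h _ (Subtype.coe_image_subset _ _), image_image, image_image]
  rfl

lemma exists_constructed_transversal {W R : Type u} [Finite R] (A : W → Set R) {S : Set W}
    (hS : S.Finite) :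
    ∃ N : Matroid (R ⊕ W), Constructed U00.{u} N ∧ N.E = range Sum.inl ∪ Sum.inr '' S ∧
      ∀ T ⊆ S, ∀ X, N.Indep (Sum.inl '' X ∪ Sum.inr '' T) ↔ HasSDRAvoiding A T X := by
  induction S, hS using Set.Finite.induction_on with
  | empty =>
    refine ⟨freeOn (range Sum.inl), constructed_freeOn (finite_range _), by simp, fun T hT X ↦ ?_⟩
    obtain rfl := subset_empty_iff.1 hT
    exact iff_of_true (freeOn_indep (by simp))
      ⟨isEmptyElim, fun w ↦ w.2.elim, fun w ↦ w.2.elim⟩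
  | @insert w S hw hS ih =>
    obtain ⟨N, hN, hE, hind⟩ := ih
    have hwE : Sum.inr w ∉ N.E := by simp [hE, hw]
    have hA : Sum.inl '' A w ⊆ N.E := hE ▸ subset_union_of_subset_left (image_subset_range _ _) _
    have : N.Finite := ⟨hE ▸ (finite_range _).union (hS.image _)⟩
    obtain ⟨N', hN'⟩ := exists_isPrincipalExtension (N.isFlat_closure (Sum.inl '' A w)) hwE
    refine ⟨N', .principal hN' hN, by rw [hN'.ground, hE, image_insert_eq, union_insert],
      fun T hT X ↦ ?_⟩
    have hE' {T : Set W} (hT : T ⊆ S) : Sum.inl '' X ∪ Sum.inr '' T ⊆ N.E :=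
      hE ▸ union_subset_union (image_subset_range _ _) (image_mono hT)
    by_cases hwT : w ∈ T
    · have hwT' : w ∉ T \ {w} := fun h ↦ h.2 rfl
      have hT' : T \ {w} ⊆ S := sdiff_singleton_subset_iff.2 hT
      rw [← insert_sdiff_self_of_mem hwT, image_insert_eq, union_insert,
        indep_insert_iff_of_isPrincipalExtension hN' hA (hE' hT'), hasSDRAvoiding_insert_iff hwT']
      constructor
      · rintro ⟨_, ⟨⟨u, hu, rfl⟩, huX⟩, h⟩
        refine ⟨u, ⟨hu, fun h ↦ huX (.inl (mem_image_of_mem _ h))⟩, ?_⟩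
        rwa [← hind _ hT', image_insert_eq, insert_union]
      · rintro ⟨u, ⟨hu, huX⟩, h⟩
        refine ⟨Sum.inl u, ⟨mem_image_of_mem _ hu, by simpa using huX⟩, ?_⟩
        rwa [← hind _ hT', image_insert_eq, insert_union] at h
    · have hT' : T ⊆ S := (subset_insert_iff_of_notMem hwT).1 hT
      rw [indep_iff_of_deleteElem_eq hN'.delete_eq fun h ↦ hwE (hE' hT' h), hind T hT']

lemma IsPresented.constructed (h : IsPresented M) : Constructed U00.{u} M := by
  obtain ⟨W, R, _, _, A, T, φ, hφ, h⟩ := h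
  obtain ⟨N, hN, hE, hind⟩ := exists_constructed_transversal A T.toFinite
  replace hind := hind T subset_rfl
  have hT : N.Indep (Sum.inr '' T) := by
    have h₀ := (hind ∅).2 (by simpa using (h ∅ (empty_subset _)).1 M.empty_indep)
    rwa [image_empty, empty_union] at h₀
  refine constructed_of_image (f := Sum.inl ∘ φ)
    ((hN.contract (Sum.inr '' T)).delete (Sum.inl '' (φ '' M.E))ᶜ)
    (Sum.inl_injective.comp_injOn hφ) ?_ fun I hI ↦ ?_
  · rw [delete_ground, contract_ground, hE, image_comp]
    ext (x | x) <;> simp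
  · rw [delete_indep_iff, hT.contract_indep_iff, image_comp, hind, h I hI,
      disjoint_compl_right_iff_subset, and_iff_right disjoint_image_inl_image_inr,
      and_iff_left (image_mono (image_mono hI))]

end Constructed

section ClosedClass

variable {α β : Type u} {M : Matroid α}

lemma finite_of_isGammoid (h : M.IsGammoid) : M.Finite := by
  obtain ⟨V, _, -, -, φ, -⟩ := h
  exact ⟨Finite.of_injective φ φ.injective⟩

lemma isGammoid_mapSetEquiv {E : Set β} (h : M.IsGammoid) (e : M.E ≃ E) :
    (M.mapSetEquiv e).IsGammoid := by
  obtain ⟨V, hV, D, B, φ, h⟩ := h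
  refine ⟨V, hV, D, B, e.symm.toEmbedding.trans φ, fun (I : Set E) ↦ ?_⟩
  exact (mapSetEquiv_indep_image_val_iff e I).trans (by rw [h, image_image]; rfl)

lemma isGammoid_U00 : U00.{u}.IsGammoid := by
  refine ⟨PEmpty, inferInstance, ⊥, ∅, ⟨(↑), Subtype.val_injective⟩,
    fun I ↦ iff_of_true ?_ ⟨fun x ↦ x.elim, fun x ↦ x.elim, fun x ↦ x.elim⟩⟩
  exact emptyOn_indep_iff.2 (eq_empty_of_isEmpty _)

lemma isClosedClass_isGammoid : IsClosedClass.{u} fun _ M ↦ M.IsGammoid where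
  finite := finite_of_isGammoid
  nonempty := ⟨_, _, isGammoid_U00⟩
  iso e h := isGammoid_mapSetEquiv h e
  minor := by
    rintro α M N ⟨C, D, rfl⟩ h
    exact isGammoid_iff_isPresented.2 (((isGammoid_iff_isPresented.1 h).contract C).delete D)
  addColoop h' h :=
    isGammoid_iff_isPresented.2 <|
      isPresented_of_isColoopExtension (isGammoid_iff_isPresented.1 h) h'
  principal h' h :=
    isGammoid_iff_isPresented.2 <|
      isPresented_of_isPrincipalExtension (isGammoid_iff_isPresented.1 h) h'

lemma mem_of_constructed {𝓒 : MatroidClass.{u}} (h𝓒 : IsClosedClass 𝓒)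
    (h : Constructed U00.{u} M) : 𝓒 α M := by
  induction h with
  | base =>
    obtain ⟨β, L, hL⟩ := h𝓒.nonempty
    have : IsEmpty (L ＼ L.E).E := isEmpty_coe_sort.2 Set.sdiff_self
    have h := h𝓒.iso (Equiv.equivOfIsEmpty (L ＼ L.E).E (∅ : Set PEmpty.{u + 1}))
      (h𝓒.minor ⟨∅, L.E, by simp⟩ hL)
    rwa [eq_emptyOn (mapSetEquiv _ _)] at h
  | relabel e _ ih => exact h𝓒.iso e ih
  | delete D _ ih => exact h𝓒.minor ⟨∅, D, by simp⟩ ih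
  | contract C _ ih => exact h𝓒.minor ⟨C, ∅, by simp⟩ ih
  | addColoop h _ ih => exact h𝓒.addColoop h ih
  | principal h _ ih => exact h𝓒.principal h ih

end ClosedClass

end Gammoid

theorem theorem3p3 :
    (∀ (α : Type u) (M : Matroid α), M.IsGammoid ↔ Matroid.Constructed Matroid.U00.{u} M) ∧
    IsLeast {𝓒 : Matroid.MatroidClass.{u} | Matroid.IsClosedClass 𝓒}
      (fun _ M => M.IsGammoid) := by
  have hconstr {α : Type u} {M : Matroid α} (h : M.IsGammoid) :
      Matroid.Constructed Matroid.U00.{u} M :=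
    (Gammoid.isGammoid_iff_isPresented.1 h).constructed
  have hclosed := Gammoid.isClosedClass_isGammoid.{u}
  exact ⟨fun _ _ ↦ ⟨hconstr, Gammoid.mem_of_constructed hclosed⟩, hclosed,
    fun _ h𝓒 _ _ h ↦ Gammoid.mem_of_constructed h𝓒 (hconstr h)⟩
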